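/- Let $\mathcal S$ be a field. Propositions are given by $A ::= \top \mid \bot \mid A\Rightarrow A\mid A\wedge A\mid A\vee A$, and $\mathcal V$ is the smallest set of propositions that contains $\top$ and is closed under $\wedge$. Proof-terms, taken modulo $\alpha$-equivalence, are given by $$t ::= x\mid t+ u\mid a\bullet t\mid a.\star\mid \delta_\top(t,u)\mid\delta_\bot(t)\mid\lambda x.t\mid t\,u\mid\langle t,u\rangle\mid\delta^1_\wedge(t,x.u)\mid\delta^2_\wedge(t,x.u)\mid\mathrm{inl}(t)\mid\mathrm{inr}(t)\mid\delta_\vee(t,x.u,y.v)$$ with $a\in\mathcal S$. Contexts are finite sets of declarations $x:A$ of distinct variables, and $\Gamma,\Delta$ denotes a disjoint union. The typing rules are: * $x:A\vdash x:A$; and $\vdash a.\star:\top$; * if $\Gamma\vdash t:A$ and $\Gamma\vdash u:A$ then $\Gamma\vdash t+ u:A$ and $\Gamma\vdash a\bullet t:A$; * if $\Gamma\vdash t:\top$ and $\Delta\vdash u:A$ then $\Gamma,\Delta\vdash\delta_\top(t,u):A$; * if $\Gamma\vdash t:\bot$ then $\Gamma,\Delta\vdash\delta_\bot(t):C$ for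 all $\Delta$ and $C$; * if $\Gamma,x:A\vdash t:B$ then $\Gamma\vdash\lambda x.t:A\Rightarrow B$; if $\Gamma\vdash t:A\Rightarrow B$ and $\Delta\vdash u:A$ then $\Gamma,\Delta\vdash t\,u:B$; * if $\Gamma\vdash t:A$ and $\Gamma\vdash u:B$ then $\Gamma\vdash\langle t,u\rangle:A\wedge B$; if $\Gamma\vdash t:A_1\wedge A_2$ and $\Delta,x:A_i\vdash u:C$ then $\Gamma,\Delta\vdash\delta_\wedge^i(t,x.u):C$, for $i=1,2$; * if $\Gamma\vdash t:A$ then $\Gamma\vdash\mathrm{inl}(t):A\vee B$; if $\Gamma\vdash t:B$ then $\Gamma\vdash\mathrm{inr}(t):A\vee B$; if $\Gamma\vdash t:A\vee B$, $\Delta,x:A\vdash u:C$ and $\Delta,y:B\vdash v:C$ then $\Gamma,\Delta\vdash\delta_\vee(t,x.u,y.v):C$. Reduction $\longrightarrow$ is the closure under all term constructors (binders included) of the rules below, where $(u/x)t$ is capture-avoiding substitution: $$\begin{array}{ll} \delta_\top(a.\star,t)\to a\bullet t, & (\lambda x.t)\,u\to(u/x)t,\\ \delta^1_\wedge(\langle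 t,u\rangle,x.v)\to(t/x)v, & \delta^2_\wedge(\langle t,u\rangle,x.v)\to(u/x)v,\\ \delta_\vee(\mathrm{inl}(t),x.v,y.w)\to(t/x)v, & \delta_\vee(\mathrm{inr}(u),x.v,y.w)\to(u/y)w,\\ a.\star+ b.\star\to(a+b).\star, & a\bullet b.\star\to(ab).\star,\\ \lambda x.t+\lambda x.u\to\lambda x.(t+ u), & a\bullet\lambda x.t\to\lambda x.(a\bullet t),\\ \langle t,u\rangle+\langle v,w\rangle\to\langle t+ v,u+ w\rangle, & a\bullet\langle t,u\rangle\to\langle a\bullet t,a\bullet u\rangle,\\ \delta_\vee(t+ u,x.v,y.w)\to\delta_\vee(t,x.v,y.w)+\delta_\vee(u,x.v,y.w), & \delta_\vee(a\bullet t,x.v,y.w)\to a\bullet\delta_\vee(t,x.v,y.w). \end{array}$$ A proof-term is irreducible if no reduction step applies to it, and $\equiv$ is the reflexive-symmetric-transitive closure of $\longrightarrow$. **Theorem (Linearity).** Let $A$ be a proposition, $B\in\mathcal V$, $t$ an irreducible proof-term with $x:A\vdash t:B$, and $u_1,u_2$ proof-terms with $\vdash u_1:A$ and $\vdash u_2:A$.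 Write $t\{u\}$ for $(u/x)t$. Then $$t\{u_1+ u_2\}\equiv t\{u_1\}+ t\{u_2\}\qquad\text{and}\qquad t\{a\bullet u_1\}\equiv a\bullet t\{u_1\}\ \text{ for every } a\in\mathcal S.$$ -/

import Mathlib

namespace LinCalc

/-- Propositions: `A = ⊤ | ⊥ | A ⇒ A | A ∧ A | A ∨ A`. -/
inductive Proposition : Type
  | top : Proposition
  | bot : Proposition
  | imp : Proposition → Proposition → Proposition
  | and : Proposition → Proposition → Proposition
  | or : Proposition → Proposition → Proposition

/-- The set `𝒱`: it contains `⊤` and is closed under `∧`. -/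
inductive InV : Proposition → Prop
  | top : InV Proposition.top
  | and {A B : Proposition} : InV A → InV B → InV (Proposition.and A B)

/-- Proof-terms with scalars in `S`, modulo α-equivalence: variables are de Bruijn indices.
The body of `lam`, the last argument of `elimAnd1` and `elimAnd2`, and the last two arguments
of `elimOr` are each under one binder (index `0` is the bound variable). -/
inductive Term (S : Type*) : Type _
  | var : ℕ → Term S
  | sum : Term S → Term S → Term S
  | prod : S → Term S → Term S
  | star : S → Term S
  | elimTop : Term S → Term S → Term S
  | elimBot : Term S → Term S
  | lam : Term S → Term S
  | app : Term S → Term S → Term S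
  | pair : Term S → Term S → Term S
  | elimAnd1 : Term S → Term S → Term S
  | elimAnd2 : Term S → Term S → Term S
  | inl : Term S → Term S
  | inr : Term S → Term S
  | elimOr : Term S → Term S → Term S → Term S

namespace Term

variable {S : Type*}

/-- Extension of a renaming under one binder. -/
def upRen (ρ : ℕ → ℕ) : ℕ → ℕ
  | 0 => 0
  | n + 1 => ρ n + 1

/-- Renaming of the free variables. -/
def rename : (ℕ → ℕ) → Term S → Term S
  | ρ, var n => var (ρ n)
  | ρ, sum t u => sum (rename ρ t) (rename ρ u)
  | ρ, prod a t => prod a (rename ρ t)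
  | _, star a => star a
  | ρ, elimTop t u => elimTop (rename ρ t) (rename ρ u)
  | ρ, elimBot t => elimBot (rename ρ t)
  | ρ, lam t => lam (rename (upRen ρ) t)
  | ρ, app t u => app (rename ρ t) (rename ρ u)
  | ρ, pair t u => pair (rename ρ t) (rename ρ u)
  | ρ, elimAnd1 t u => elimAnd1 (rename ρ t) (rename (upRen ρ) u)
  | ρ, elimAnd2 t u => elimAnd2 (rename ρ t) (rename (upRen ρ) u)
  | ρ, inl t => inl (rename ρ t)
  | ρ, inr t => inr (rename ρ t)
  | ρ, elimOr t u v => elimOr (rename ρ t) (rename (upRen ρ) u) (rename (upRen ρ) v)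

/-- Extension of a simultaneous substitution under one binder. -/
def upSubst (σ : ℕ → Term S) : ℕ → Term S
  | 0 => var 0
  | n + 1 => rename Nat.succ (σ n)

/-- Capture-avoiding simultaneous substitution. -/
def subst : (ℕ → Term S) → Term S → Term S
  | σ, var n => σ n
  | σ, sum t u => sum (subst σ t) (subst σ u)
  | σ, prod a t => prod a (subst σ t)
  | _, star a => star a
  | σ, elimTop t u => elimTop (subst σ t) (subst σ u)
  | σ, elimBot t => elimBot (subst σ t)
  | σ, lam t => lam (subst (upSubst σ) t)
  | σ, app t u => app (subst σ t) (subst σ u)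
  | σ, pair t u => pair (subst σ t) (subst σ u)
  | σ, elimAnd1 t u => elimAnd1 (subst σ t) (subst (upSubst σ) u)
  | σ, elimAnd2 t u => elimAnd2 (subst σ t) (subst (upSubst σ) u)
  | σ, inl t => inl (subst σ t)
  | σ, inr t => inr (subst σ t)
  | σ, elimOr t u v => elimOr (subst σ t) (subst (upSubst σ) u) (subst (upSubst σ) v)

/-- The substitution sending the variable `0` to `u`; the other variables are lowered by one,
since the binder of the variable `0` disappears. -/
def single (u : Term S) : ℕ → Term S
  | 0 => u
  | n + 1 => var n

/-- `(u/x)t`, where `x` is the variable `0` of `t`; this is `t{u}` when `FV(t) ⊆ {x}`. -/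
def inst (t u : Term S) : Term S := subst (single u) t

end Term

open Term

/-- Contexts, as partial maps from variables to propositions. All the contexts in a derivation
of a judgement with a finite context are finite. -/
abbrev Ctx : Type := ℕ → Option Proposition

namespace Ctx

/-- The empty context. -/
def empty : Ctx := fun _ => none

/-- `Γ, x:A`, where `x` is the new variable `0`. -/
def cons (A : Proposition) (Γ : Ctx) : Ctx
  | 0 => some A
  | n + 1 => Γ n

/-- `Split Θ Γ Δ` says that `Γ` and `Δ` have disjoint domains and that `Θ = Γ, Δ`. -/
def Split (Θ Γ Δ : Ctx) : Prop :=
  ∀ n, (Γ n = Θ n ∧ Δ n = none) ∨ (Γ n = none ∧ Δ n = Θ n)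

end Ctx

/-- The typing judgement `Γ ⊢ t : A`. -/
inductive HasType {S : Type*} : Ctx → Term S → Proposition → Prop
  | ax {Γ : Ctx} {n : ℕ} {A : Proposition} :
      Γ n = some A → (∀ m, m ≠ n → Γ m = none) → HasType Γ (var n) A
  | sum {Γ : Ctx} {t u : Term S} {A : Proposition} :
      HasType Γ t A → HasType Γ u A → HasType Γ (sum t u) A
  | prod {Γ : Ctx} {t : Term S} {A : Proposition} (a : S) :
      HasType Γ t A → HasType Γ (prod a t) A
  | topI {Γ : Ctx} (a : S) :
      (∀ n, Γ n = none) → HasType Γ (star a) Proposition.top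
  | topE {Θ Γ Δ : Ctx} {t u : Term S} {A : Proposition} :
      Ctx.Split Θ Γ Δ → HasType Γ t Proposition.top → HasType Δ u A →
      HasType Θ (elimTop t u) A
  | botE {Θ Γ Δ : Ctx} {t : Term S} {C : Proposition} :
      Ctx.Split Θ Γ Δ → HasType Γ t Proposition.bot → HasType Θ (elimBot t) C
  | impI {Γ : Ctx} {t : Term S} {A B : Proposition} :
      HasType (Ctx.cons A Γ) t B → HasType Γ (lam t) (Proposition.imp A B)
  | impE {Θ Γ Δ : Ctx} {t u : Term S} {A B : Proposition} :
      Ctx.Split Θ Γ Δ → HasType Γ t (Proposition.imp A B) → HasType Δ u A →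
      HasType Θ (app t u) B
  | andI {Γ : Ctx} {t u : Term S} {A B : Proposition} :
      HasType Γ t A → HasType Γ u B → HasType Γ (pair t u) (Proposition.and A B)
  | andE1 {Θ Γ Δ : Ctx} {t u : Term S} {A B C : Proposition} :
      Ctx.Split Θ Γ Δ → HasType Γ t (Proposition.and A B) → HasType (Ctx.cons A Δ) u C →
      HasType Θ (elimAnd1 t u) C
  | andE2 {Θ Γ Δ : Ctx} {t u : Term S} {A B C : Proposition} :
      Ctx.Split Θ Γ Δ → HasType Γ t (Proposition.and A B) → HasType (Ctx.cons B Δ) u C →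
      HasType Θ (elimAnd2 t u) C
  | orI1 {Γ : Ctx} {t : Term S} {A B : Proposition} :
      HasType Γ t A → HasType Γ (inl t) (Proposition.or A B)
  | orI2 {Γ : Ctx} {t : Term S} {A B : Proposition} :
      HasType Γ t B → HasType Γ (inr t) (Proposition.or A B)
  | orE {Θ Γ Δ : Ctx} {t u v : Term S} {A B C : Proposition} :
      Ctx.Split Θ Γ Δ → HasType Γ t (Proposition.or A B) →
      HasType (Ctx.cons A Δ) u C → HasType (Ctx.cons B Δ) v C →
      HasType Θ (elimOr t u v) C

/-- One-step reduction `t ⟶ u`: the reduction rules, closed under all term constructors. -/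
inductive Step {S : Type*} [Field S] : Term S → Term S → Prop
  -- reduction of cuts
  | topBeta (a : S) (t : Term S) : Step (elimTop (star a) t) (prod a t)
  | impBeta (t u : Term S) : Step (app (lam t) u) (inst t u)
  | andBeta1 (t u v : Term S) : Step (elimAnd1 (pair t u) v) (inst v t)
  | andBeta2 (t u v : Term S) : Step (elimAnd2 (pair t u) v) (inst v u)
  | orBeta1 (t v w : Term S) : Step (elimOr (inl t) v w) (inst v t)
  | orBeta2 (u v w : Term S) : Step (elimOr (inr u) v w) (inst w u)
  -- commutation of sums
  | sumStar (a b : S) : Step (sum (star a) (star b)) (star (a + b))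
  | sumLam (t u : Term S) : Step (sum (lam t) (lam u)) (lam (sum t u))
  | sumPair (t u v w : Term S) :
      Step (sum (pair t u) (pair v w)) (pair (sum t v) (sum u w))
  | sumOr (t u v w : Term S) :
      Step (elimOr (sum t u) v w) (sum (elimOr t v w) (elimOr u v w))
  -- commutation of products
  | prodStar (a b : S) : Step (prod a (star b)) (star (a * b))
  | prodLam (a : S) (t : Term S) : Step (prod a (lam t)) (lam (prod a t))
  | prodPair (a : S) (t u : Term S) :
      Step (prod a (pair t u)) (pair (prod a t) (prod a u))
  | prodOr (a : S) (t v w : Term S) :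
      Step (elimOr (prod a t) v w) (prod a (elimOr t v w))
  -- closure under the term constructors
  | congrSumL {t t' : Term S} (u : Term S) : Step t t' → Step (sum t u) (sum t' u)
  | congrSumR (t : Term S) {u u' : Term S} : Step u u' → Step (sum t u) (sum t u')
  | congrProd (a : S) {t t' : Term S} : Step t t' → Step (prod a t) (prod a t')
  | congrElimTopL {t t' : Term S} (u : Term S) :
      Step t t' → Step (elimTop t u) (elimTop t' u)
  | congrElimTopR (t : Term S) {u u' : Term S} :
      Step u u' → Step (elimTop t u) (elimTop t u')
  | congrElimBot {t t' : Term S} : Step t t' → Step (elimBot t) (elimBot t')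
  | congrLam {t t' : Term S} : Step t t' → Step (lam t) (lam t')
  | congrAppL {t t' : Term S} (u : Term S) : Step t t' → Step (app t u) (app t' u)
  | congrAppR (t : Term S) {u u' : Term S} : Step u u' → Step (app t u) (app t u')
  | congrPairL {t t' : Term S} (u : Term S) : Step t t' → Step (pair t u) (pair t' u)
  | congrPairR (t : Term S) {u u' : Term S} : Step u u' → Step (pair t u) (pair t u')
  | congrElimAnd1L {t t' : Term S} (u : Term S) :
      Step t t' → Step (elimAnd1 t u) (elimAnd1 t' u)
  | congrElimAnd1R (t : Term S) {u u' : Term S} :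
      Step u u' → Step (elimAnd1 t u) (elimAnd1 t u')
  | congrElimAnd2L {t t' : Term S} (u : Term S) :
      Step t t' → Step (elimAnd2 t u) (elimAnd2 t' u)
  | congrElimAnd2R (t : Term S) {u u' : Term S} :
      Step u u' → Step (elimAnd2 t u) (elimAnd2 t u')
  | congrInl {t t' : Term S} : Step t t' → Step (inl t) (inl t')
  | congrInr {t t' : Term S} : Step t t' → Step (inr t) (inr t')
  | congrElimOr1 {t t' : Term S} (u v : Term S) :
      Step t t' → Step (elimOr t u v) (elimOr t' u v)
  | congrElimOr2 (t : Term S) {u u' : Term S} (v : Term S) :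
      Step u u' → Step (elimOr t u v) (elimOr t u' v)
  | congrElimOr3 (t u : Term S) {v v' : Term S} :
      Step v v' → Step (elimOr t u v) (elimOr t u v')

/-- A proof-term is irreducible if no reduction step applies to it. -/
def Irreducible {S : Type*} [Field S] (t : Term S) : Prop := ∀ u, ¬ Step t u

/-- Convertibility `≡`: the reflexive-symmetric-transitive closure of reduction. -/
def Conv {S : Type*} [Field S] : Term S → Term S → Prop := Relation.EqvGen Step

end LinCalc

/-! Interpret propositions as vector spaces: `⊤` is the field, `⇒` the space of linear maps, `∧` and
`∨` both the direct sum. Typing is linear, so a judgement denotes a function of the environment that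
is linear in each variable of its context; a term with one free variable denotes a linear map `g`.

A logical relation `Realizes` ties terms to vectors. Being closed under conversion, sums and scalar
multiples, it holds between every typed term and its denotation (`HasType.exists_denotes`). If `u₁`,
`u₂` realize `x₁`, `x₂`, then `t{u₁ + u₂}` realizes `g (x₁ + x₂)` and `t{u₁} + t{u₂}` realizes `g x₁
+ g x₂`, the same vector. On `𝒱` realizers of one vector are convertible (`Realizes.conv_of_inV`),
which concludes; scalars are alike. -/

namespace LinCalc

open Term

universe u

/-! ### Substitution calculus -/

namespace Term

variable {S : Type*}

/-- The substitution sending `0` to `u` and `n + 1` to `σ n`. -/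
def scons (u : Term S) (σ : ℕ → Term S) : ℕ → Term S
  | 0 => u
  | n + 1 => σ n

theorem upSubst_comp_upRen (σ : ℕ → Term S) (ρ : ℕ → ℕ) :
    upSubst σ ∘ upRen ρ = upSubst (σ ∘ ρ) := by
  funext n; cases n <;> rfl

theorem subst_rename (t : Term S) (ρ : ℕ → ℕ) (σ : ℕ → Term S) :
    subst σ (rename ρ t) = subst (σ ∘ ρ) t := by
  induction t generalizing ρ σ <;> simp_all [rename, subst, upSubst_comp_upRen]

theorem rename_eq_subst (t : Term S) (ρ : ℕ → ℕ) :
    rename ρ t = subst (fun n => var (ρ n)) t := by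
  have h (ρ : ℕ → ℕ) :
      upSubst (fun n => (var (ρ n) : Term S)) = fun n => var (upRen ρ n) := by
    funext n; cases n <;> rfl
  induction t generalizing ρ <;> simp_all [rename, subst]

theorem rename_rename (t : Term S) (ρ τ : ℕ → ℕ) :
    rename τ (rename ρ t) = rename (τ ∘ ρ) t := by
  rw [rename_eq_subst (rename ρ t), subst_rename, rename_eq_subst]; rfl

theorem rename_subst (t : Term S) (ρ : ℕ → ℕ) (σ : ℕ → Term S) :
    rename ρ (subst σ t) = subst (fun n => rename ρ (σ n)) t := by
  have h (ρ : ℕ → ℕ) (σ : ℕ → Term S) :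
      (fun n => rename (upRen ρ) (upSubst σ n)) = upSubst (fun n => rename ρ (σ n)) := by
    funext n
    cases n with
    | zero => rfl
    | succ n => simp only [upSubst, rename_rename]; rfl
  induction t generalizing ρ σ <;> simp_all [rename, subst]

theorem subst_subst (t : Term S) (σ τ : ℕ → Term S) :
    subst τ (subst σ t) = subst (fun n => subst τ (σ n)) t := by
  have h (σ τ : ℕ → Term S) :
      (fun n => subst (upSubst τ) (upSubst σ n)) = upSubst (fun n => subst τ (σ n)) := by
    funext n
    cases n with
    | zero => rfl
    | succ n => simp only [upSubst, rename_subst, subst_rename]; rfl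
  induction t generalizing σ τ <;> simp_all [subst]

theorem subst_var (t : Term S) : subst var t = t := by
  have h : upSubst (var : ℕ → Term S) = var := by funext n; cases n <;> rfl
  induction t <;> simp_all [subst]

/-- Turns the contractum of a redex into one simultaneous substitution, the form in which
realizability of a body under a binder is known. -/
theorem inst_subst_upSubst (t u : Term S) (σ : ℕ → Term S) :
    inst (subst (upSubst σ) t) u = subst (scons u σ) t := by
  rw [inst, subst_subst]
  congr 1
  funext n
  cases n with
  | zero => rfl
  | succ n => simp only [upSubst, subst_rename, scons]; exact subst_var _

end Term

/-! ### Convertibility -/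

namespace Conv

variable {S : Type*} [Field S]

theorem refl (t : Term S) : Conv t t := Relation.EqvGen.refl t

theorem symm {t u : Term S} (h : Conv t u) : Conv u t := Relation.EqvGen.symm _ _ h

theorem trans {t u v : Term S} (h : Conv t u) (h' : Conv u v) : Conv t v :=
  Relation.EqvGen.trans _ _ _ h h'

theorem of_step {t u : Term S} (h : Step t u) : Conv t u := Relation.EqvGen.rel _ _ h

theorem map {F : Term S → Term S} (hF : ∀ {t u}, Step t u → Step (F t) (F u)) {t u : Term S}
    (h : Conv t u) : Conv (F t) (F u) := by
  induction h with
  | rel _ _ h => exact of_step (hF h)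
  | refl => exact refl _
  | symm _ _ _ ih => exact ih.symm
  | trans _ _ _ _ _ ih ih' => exact ih.trans ih'

theorem sum {t t' u u' : Term S} (h : Conv t t') (h' : Conv u u') :
    Conv (t.sum u) (t'.sum u') :=
  (map (F := fun t => t.sum u) (Step.congrSumL u) h).trans
    (map (F := fun u => t'.sum u) (Step.congrSumR t') h')

theorem prod (a : S) {t t' : Term S} (h : Conv t t') : Conv (t.prod a) (t'.prod a) :=
  map (F := fun t => t.prod a) (Step.congrProd a) h

theorem pair {t t' u u' : Term S} (h : Conv t t') (h' : Conv u u') :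
    Conv (t.pair u) (t'.pair u') :=
  (map (F := fun t => t.pair u) (Step.congrPairL u) h).trans
    (map (F := fun u => t'.pair u) (Step.congrPairR t') h')

theorem app {t t' : Term S} (h : Conv t t') (u : Term S) : Conv (t.app u) (t'.app u) :=
  map (F := fun t => t.app u) (Step.congrAppL u) h

theorem elimTop {t t' : Term S} (h : Conv t t') (u : Term S) :
    Conv (t.elimTop u) (t'.elimTop u) :=
  map (F := fun t => t.elimTop u) (Step.congrElimTopL u) h

theorem elimAnd1 {t t' : Term S} (h : Conv t t') (u : Term S) :
    Conv (t.elimAnd1 u) (t'.elimAnd1 u) :=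
  map (F := fun t => t.elimAnd1 u) (Step.congrElimAnd1L u) h

theorem elimAnd2 {t t' : Term S} (h : Conv t t') (u : Term S) :
    Conv (t.elimAnd2 u) (t'.elimAnd2 u) :=
  map (F := fun t => t.elimAnd2 u) (Step.congrElimAnd2L u) h

theorem elimOr {t t' : Term S} (h : Conv t t') (u v : Term S) :
    Conv (t.elimOr u v) (t'.elimOr u v) :=
  map (F := fun t => t.elimOr u v) (Step.congrElimOr1 u v) h

/-- No rule distributes application over `+`; sums only commute with visible abstractions. Once both
heads convert to abstractions, the two sides meet at the sum of the instantiated bodies. Hence the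
convertibility clause of `Realizes` at `⇒`. -/
theorem sum_lam_app {t u b c : Term S} (ht : Conv t (lam b)) (hu : Conv u (lam c))
    (v : Term S) : Conv ((t.sum u).app v) ((t.app v).sum (u.app v)) := by
  have h₁ : Conv ((t.sum u).app v) ((b.sum c).inst v) :=
    (((ht.sum hu).trans (of_step (Step.sumLam b c))).app v).trans (of_step (Step.impBeta _ _))
  have h₂ : Conv ((t.app v).sum (u.app v)) ((b.inst v).sum (c.inst v)) :=
    ((ht.app v).trans (of_step (Step.impBeta _ _))).sum
      ((hu.app v).trans (of_step (Step.impBeta _ _)))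
  exact h₁.trans h₂.symm

theorem prod_lam_app (a : S) {t b : Term S} (ht : Conv t (lam b)) (v : Term S) :
    Conv ((t.prod a).app v) ((t.app v).prod a) := by
  have h₁ : Conv ((t.prod a).app v) ((b.prod a).inst v) :=
    (((ht.prod a).trans (of_step (Step.prodLam a b))).app v).trans (of_step (Step.impBeta _ _))
  have h₂ : Conv ((t.app v).prod a) ((b.inst v).prod a) :=
    ((ht.app v).trans (of_step (Step.impBeta _ _))).prod a
  exact h₁.trans h₂.symm

end Conv

/-! ### Denotation of propositions and multilinear functions of environments -/

/-- The vector space denoted by a proposition. -/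
noncomputable def Sem (S : Type u) [Field S] : Proposition → ModuleCat.{u} S
  | .top => ModuleCat.of S S
  | .bot => ModuleCat.of S PUnit
  -- Bundling makes the module structures of the recursive values available here.
  | .imp A B => ModuleCat.of S (Sem S A →ₗ[S] Sem S B)
  | .and A B => ModuleCat.of S (Sem S A × Sem S B)
  | .or A B => ModuleCat.of S (Sem S A × Sem S B)

/-- Environments: a value of every type for every variable. -/
abbrev Env (S : Type u) [Field S] : Type u := (n : ℕ) → (A : Proposition) → Sem S A

section Multilinear

variable {S : Type u} [Field S] {M N : Type*} [AddCommGroup M] [Module S M]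
  [AddCommGroup N] [Module S N] {Γ Δ Θ : Ctx}

open Classical in
/-- Extension of an environment with a value for the new variable `0`. -/
noncomputable def Env.cons {A : Proposition} (x : Sem S A) (ρ : Env S) : Env S
  -- The value at types other than `A` is junk: a context gives variable `0` only the type `A`.
  | 0, B => if h : A = B then h ▸ x else 0
  | n + 1, B => ρ n B

@[simp] theorem Env.cons_zero {A : Proposition} (x : Sem S A) (ρ : Env S) :
    Env.cons x ρ 0 A = x := by
  simp [Env.cons]

@[simp] theorem Env.cons_succ {A : Proposition} (x : Sem S A) (ρ : Env S) (n : ℕ)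
    (B : Proposition) : Env.cons x ρ (n + 1) B = ρ n B := rfl

/-- The two environments give the same values to the variables of `Γ`. -/
def Env.Agree (Γ : Ctx) (ρ ρ' : Env S) : Prop := ∀ n A, Γ n = some A → ρ n A = ρ' n A

/-- The two environments give the same values to the variables of `Γ` other than `n`. -/
def Env.AgreeExcept (Γ : Ctx) (n : ℕ) (ρ ρ' : Env S) : Prop :=
  ∀ m A, m ≠ n → Γ m = some A → ρ m A = ρ' m A

/-- `f` depends only on the variables of `Γ`, and linearly on each of them. -/
structure Multilinear (Γ : Ctx) (f : Env S → M) : Prop where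
  congr : ∀ ρ ρ', Env.Agree Γ ρ ρ' → f ρ = f ρ'
  -- Relating three environments, rather than updating one, lets linearity pass through context
  -- splits and extensions.
  linear : ∀ n A (a b : S) (ρ ρ₁ ρ₂ : Env S), Γ n = some A →
    Env.AgreeExcept Γ n ρ ρ₁ → Env.AgreeExcept Γ n ρ ρ₂ →
    ρ n A = a • ρ₁ n A + b • ρ₂ n A → f ρ = a • f ρ₁ + b • f ρ₂

theorem Ctx.Split.symm (h : Ctx.Split Θ Γ Δ) : Ctx.Split Θ Δ Γ :=
  fun n => (h n).symm.imp And.symm And.symm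

theorem Ctx.Split.eq_some_of_left (h : Ctx.Split Θ Γ Δ) {n : ℕ} {A : Proposition}
    (hn : Γ n = some A) : Θ n = some A := by
  rcases h n with h | h
  · rw [← h.1, hn]
  · simp [h.1] at hn

theorem Ctx.Split.eq_some_of_right (h : Ctx.Split Θ Γ Δ) {n : ℕ} {A : Proposition}
    (hn : Δ n = some A) : Θ n = some A := h.symm.eq_some_of_left hn

namespace Multilinear

/-- Zero is linear in any variable, unlike other constants, so it fits the arbitrary context of
`botE`. -/
theorem zero : Multilinear Γ (fun _ : Env S => (0 : M)) :=
  ⟨fun _ _ _ => rfl, fun _ _ _ _ _ _ _ _ _ _ _ => by simp⟩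

theorem const (hΓ : ∀ n, Γ n = none) (x : M) : Multilinear Γ (fun _ : Env S => x) :=
  ⟨fun _ _ _ => rfl, fun n A _ _ _ _ _ hn => by simp [hΓ n] at hn⟩

theorem proj {n : ℕ} {A : Proposition} (hn : Γ n = some A) (hΓ : ∀ m, m ≠ n → Γ m = none) :
    Multilinear Γ (fun ρ : Env S => ρ n A) := by
  refine ⟨fun ρ ρ' h => h n A hn, fun m C a b ρ ρ₁ ρ₂ hm _ _ h => ?_⟩
  obtain rfl : m = n := by
    by_contra hne
    simp [hΓ m hne] at hm
  obtain rfl : C = A := by simpa [hn] using hm.symm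
  exact h

theorem comp (L : M →ₗ[S] N) {f : Env S → M} (hf : Multilinear Γ f) :
    Multilinear Γ (fun ρ => L (f ρ)) := by
  refine ⟨fun ρ ρ' h => by rw [hf.congr ρ ρ' h], fun n A a b ρ ρ₁ ρ₂ hn h₁ h₂ h => ?_⟩
  rw [hf.linear n A a b ρ ρ₁ ρ₂ hn h₁ h₂ h, map_add, map_smul, map_smul]

theorem prodMk {f : Env S → M} {g : Env S → N} (hf : Multilinear Γ f) (hg : Multilinear Γ g) :
    Multilinear Γ (fun ρ => (f ρ, g ρ)) := by
  refine ⟨fun ρ ρ' h => by rw [hf.congr ρ ρ' h, hg.congr ρ ρ' h],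
    fun n A a b ρ ρ₁ ρ₂ hn h₁ h₂ h => ?_⟩
  rw [hf.linear n A a b ρ ρ₁ ρ₂ hn h₁ h₂ h, hg.linear n A a b ρ ρ₁ ρ₂ hn h₁ h₂ h]
  rfl

theorem add {f g : Env S → M} (hf : Multilinear Γ f) (hg : Multilinear Γ g) :
    Multilinear Γ (fun ρ => f ρ + g ρ) :=
  (hf.prodMk hg).comp (LinearMap.fst S M M + LinearMap.snd S M M)

theorem smul (a : S) {f : Env S → M} (hf : Multilinear Γ f) :
    Multilinear Γ (fun ρ => a • f ρ) :=
  hf.comp (a • LinearMap.id)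

/-- Linearity of typing enters here: each variable lies in only one of `Γ` and `Δ`, so one of `f`,
`g` is constant in it and the other linear. A shared variable would make the result quadratic. -/
theorem apply (hs : Ctx.Split Θ Γ Δ) {f : Env S → M →ₗ[S] N} {g : Env S → M}
    (hf : Multilinear Γ f) (hg : Multilinear Δ g) : Multilinear Θ (fun ρ => f ρ (g ρ)) := by
  refine ⟨fun ρ ρ' h => ?_, fun n A a b ρ ρ₁ ρ₂ hn h₁ h₂ h => ?_⟩
  · rw [hf.congr ρ ρ' fun n A hn => h n A (hs.eq_some_of_left hn),
      hg.congr ρ ρ' fun n A hn => h n A (hs.eq_some_of_right hn)]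
  · rcases hs n with ⟨hΓ, hΔ⟩ | ⟨hΓ, hΔ⟩
    · have key {ρ' : Env S} (h' : Env.AgreeExcept Θ n ρ ρ') : g ρ = g ρ' :=
        hg.congr ρ ρ' fun m C hm =>
          h' m C (by rintro rfl; simp [hΔ] at hm) (hs.eq_some_of_right hm)
      rw [hf.linear n A a b ρ ρ₁ ρ₂ (hΓ.trans hn)
        (fun m C hne hm => h₁ m C hne (hs.eq_some_of_left hm))
        (fun m C hne hm => h₂ m C hne (hs.eq_some_of_left hm)) h, ← key h₁, ← key h₂]
      rfl
    · have key {ρ' : Env S} (h' : Env.AgreeExcept Θ n ρ ρ') : f ρ = f ρ' :=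
        hf.congr ρ ρ' fun m C hm =>
          h' m C (by rintro rfl; simp [hΓ] at hm) (hs.eq_some_of_left hm)
      rw [hg.linear n A a b ρ ρ₁ ρ₂ (hΔ.trans hn)
        (fun m C hne hm => h₁ m C hne (hs.eq_some_of_right hm))
        (fun m C hne hm => h₂ m C hne (hs.eq_some_of_right hm)) h, ← key h₁, ← key h₂]
      simp

theorem cons_linear {A : Proposition} {f : Env S → M} (hf : Multilinear (Ctx.cons A Γ) f)
    (a b : S) (x y : Sem S A) (ρ : Env S) :
    f (Env.cons (a • x + b • y) ρ) = a • f (Env.cons x ρ) + b • f (Env.cons y ρ) := by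
  have key (z w : Sem S A) :
      Env.AgreeExcept (Ctx.cons A Γ) 0 (Env.cons z ρ) (Env.cons w ρ) := by
    intro m C hne _
    cases m with
    | zero => exact absurd rfl hne
    | succ m => rfl
  exact hf.linear 0 A a b _ _ _ rfl (key _ _) (key _ _) (by simp)

theorem curry {A : Proposition} {f : Env S → M} (hf : Multilinear (Ctx.cons A Γ) f) :
    ∃ g : Env S → Sem S A →ₗ[S] M, Multilinear Γ g ∧ ∀ ρ x, g ρ x = f (Env.cons x ρ) := by
  refine ⟨fun ρ =>
    { toFun := fun x => f (Env.cons x ρ)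
      -- Coefficients `1, 1` give additivity, and `a, 0` homogeneity.
      map_add' := fun x y => by simpa using hf.cons_linear 1 1 x y ρ
      map_smul' := fun a x => by simpa using hf.cons_linear a 0 x 0 ρ }, ⟨?_, ?_⟩,
    fun _ _ => rfl⟩
  · intro ρ ρ' h
    ext x
    refine hf.congr _ _ fun n C hn => ?_
    cases n with
    | zero =>
      obtain rfl : A = C := Option.some.inj hn
      simp
    | succ n => exact h n C hn
  · intro n C a b ρ ρ₁ ρ₂ hn h₁ h₂ h
    ext x
    have key {ρ' : Env S} (h' : Env.AgreeExcept Γ n ρ ρ') :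
        Env.AgreeExcept (Ctx.cons A Γ) (n + 1) (Env.cons x ρ) (Env.cons x ρ') := by
      intro m D hne hm
      cases m with
      | zero =>
        obtain rfl : A = D := Option.some.inj hm
        simp
      | succ m => exact h' m D (fun e => hne (by rw [e])) hm
    exact hf.linear (n + 1) C a b _ _ _ hn (key h₁) (key h₂) h

end Multilinear

end Multilinear

/-! ### Realizability -/

section Realizability

variable {S : Type u} [Field S]

/-- The realizers of the elements of a direct sum: terms convertible to linear combinations of
injections of realizers. -/
inductive RealizesOr {M N : Type*} [AddCommGroup M] [Module S M] [AddCommGroup N] [Module S N]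
    (P : Term S → M → Prop) (Q : Term S → N → Prop) : Term S → M × N → Prop
  | inl {t x} : P t x → RealizesOr P Q (inl t) (x, 0)
  | inr {t y} : Q t y → RealizesOr P Q (inr t) (0, y)
  | sum {t u z w} : RealizesOr P Q t z → RealizesOr P Q u w → RealizesOr P Q (sum t u) (z + w)
  | prod (a : S) {t z} : RealizesOr P Q t z → RealizesOr P Q (prod a t) (a • z)
  | conv {t u z} : Conv t u → RealizesOr P Q u z → RealizesOr P Q t z

/-- The logical relation between proof-terms and elements of the denotations. -/
def Realizes : (A : Proposition) → Term S → Sem S A → Prop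
  | .top, t, (x : S) => Conv t (star x)
  | .bot, _, _ => False
  | .imp A B, t, (f : Sem S A →ₗ[S] Sem S B) =>
      (∃ b, Conv t (lam b)) ∧ ∀ u x, Realizes A u x → Realizes B (app t u) (f x)
  | .and A B, t, (z : Sem S A × Sem S B) =>
      ∃ u v, Conv t (pair u v) ∧ Realizes A u z.1 ∧ Realizes B v z.2
  | .or A B, t, (z : Sem S A × Sem S B) => RealizesOr (Realizes A) (Realizes B) t z

namespace Realizes

theorem conv {A : Proposition} {t u : Term S} {x : Sem S A} (h : Conv t u)
    (hu : Realizes A u x) : Realizes A t x := by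
  induction A generalizing t u with
  | top => exact h.trans hu
  | bot => exact hu
  | imp A B _ ih =>
    obtain ⟨⟨b, hb⟩, hu⟩ := hu
    exact ⟨⟨b, h.trans hb⟩, fun v y hv => ih (h.app v) (hu v y hv)⟩
  | and A B _ _ =>
    obtain ⟨v, w, hvw, hv⟩ := hu
    exact ⟨v, w, h.trans hvw, hv⟩
  | or A B _ _ => exact RealizesOr.conv h hu

theorem sum {A : Proposition} {t u : Term S} {x y : Sem S A} (ht : Realizes A t x)
    (hu : Realizes A u y) : Realizes A (t.sum u) (x + y) := by
  induction A generalizing t u with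
  | top => exact (Conv.sum ht hu).trans (Conv.of_step (Step.sumStar _ _))
  | bot => exact ht
  | imp A B _ ih =>
    obtain ⟨⟨b, hb⟩, ht⟩ := ht
    obtain ⟨⟨c, hc⟩, hu⟩ := hu
    exact ⟨⟨b.sum c, (hb.sum hc).trans (Conv.of_step (Step.sumLam b c))⟩, fun v z hv =>
      conv (Conv.sum_lam_app hb hc v) (ih (ht v z hv) (hu v z hv))⟩
  | and A B ihA ihB =>
    obtain ⟨t₁, t₂, h, h₁, h₂⟩ := ht
    obtain ⟨u₁, u₂, h', h₁', h₂'⟩ := hu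
    exact ⟨_, _, (h.sum h').trans (Conv.of_step (Step.sumPair _ _ _ _)), ihA h₁ h₁', ihB h₂ h₂'⟩
  | or A B _ _ => exact RealizesOr.sum ht hu

theorem prod (a : S) {A : Proposition} {t : Term S} {x : Sem S A} (ht : Realizes A t x) :
    Realizes A (t.prod a) (a • x) := by
  induction A generalizing t with
  | top => exact (Conv.prod a ht).trans (Conv.of_step (Step.prodStar _ _))
  | bot => exact ht
  | imp A B _ ih =>
    obtain ⟨⟨b, hb⟩, ht⟩ := ht
    exact ⟨⟨b.prod a, (hb.prod a).trans (Conv.of_step (Step.prodLam a b))⟩, fun v z hv =>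
      conv (Conv.prod_lam_app a hb v) (ih (ht v z hv))⟩
  | and A B ihA ihB =>
    obtain ⟨t₁, t₂, h, h₁, h₂⟩ := ht
    exact ⟨_, _, (h.prod a).trans (Conv.of_step (Step.prodPair _ _ _)), ihA h₁, ihB h₂⟩
  | or A B _ _ => exact RealizesOr.prod a ht

/-- In `𝒱`, the denotation determines the realizers up to convertibility. -/
theorem conv_of_inV {B : Proposition} (hB : InV B) {t u : Term S} {x : Sem S B}
    (ht : Realizes B t x) (hu : Realizes B u x) : Conv t u := by
  induction hB generalizing t u with
  | top => exact Conv.trans ht (Conv.symm hu)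
  | and _ _ ihA ihB =>
    obtain ⟨t₁, t₂, h, h₁, h₂⟩ := ht
    obtain ⟨u₁, u₂, h', h₁', h₂'⟩ := hu
    exact h.trans (((ihA h₁ h₁').pair (ihB h₂ h₂')).trans h'.symm)

/-- Induction on how `t` realizes `z`: injections are β-redexes, while sums and multiples of
realizers commute out of the eliminator, matching linearity of `f.coprod g`. -/
theorem elimOr {A B C : Proposition} {t v w : Term S} {z : Sem S A × Sem S B}
    (f : Sem S A →ₗ[S] Sem S C) (g : Sem S B →ₗ[S] Sem S C)
    (ht : RealizesOr (Realizes A) (Realizes B) t z)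
    (hv : ∀ u x, Realizes A u x → Realizes C (v.inst u) (f x))
    (hw : ∀ u y, Realizes B u y → Realizes C (w.inst u) (g y)) :
    Realizes C (t.elimOr v w) (f.coprod g z) := by
  induction ht with
  | inl h => simpa using conv (Conv.of_step (Step.orBeta1 _ _ _)) (hv _ _ h)
  | inr h => simpa using conv (Conv.of_step (Step.orBeta2 _ _ _)) (hw _ _ h)
  | sum _ _ ih ih' =>
    rw [map_add]
    exact conv (Conv.of_step (Step.sumOr _ _ _ _)) (sum ih ih')
  | prod a _ ih =>
    rw [map_smul]
    exact conv (Conv.of_step (Step.prodOr _ _ _ _)) (prod a ih)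
  | conv h _ ih => exact conv (h.elimOr v w) ih

end Realizes

/-- The substitution `σ` realizes the environment `ρ` on the context `Γ`. -/
def RealizesEnv (Γ : Ctx) (σ : ℕ → Term S) (ρ : Env S) : Prop :=
  ∀ n A, Γ n = some A → Realizes A (σ n) (ρ n A)

theorem RealizesEnv.cons {Γ : Ctx} {σ : ℕ → Term S} {ρ : Env S} (h : RealizesEnv Γ σ ρ)
    {A : Proposition} {u : Term S} {x : Sem S A} (hu : Realizes A u x) :
    RealizesEnv (Ctx.cons A Γ) (scons u σ) (Env.cons x ρ) := by
  intro n C hn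
  cases n with
  | zero =>
    obtain rfl : A = C := Option.some.inj hn
    simpa [scons] using hu
  | succ n => exact h n C hn

theorem RealizesEnv.left {Θ Γ Δ : Ctx} {σ : ℕ → Term S} {ρ : Env S} (h : RealizesEnv Θ σ ρ)
    (hs : Ctx.Split Θ Γ Δ) : RealizesEnv Γ σ ρ :=
  fun n A hn => h n A (hs.eq_some_of_left hn)

theorem RealizesEnv.right {Θ Γ Δ : Ctx} {σ : ℕ → Term S} {ρ : Env S} (h : RealizesEnv Θ σ ρ)
    (hs : Ctx.Split Θ Γ Δ) : RealizesEnv Δ σ ρ :=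
  h.left hs.symm

/-- `f` is a denotation of the judgement `Γ ⊢ t : A`. -/
structure Denotes (Γ : Ctx) (t : Term S) (A : Proposition) (f : Env S → Sem S A) : Prop where
  multilinear : Multilinear Γ f
  realizes : ∀ σ ρ, RealizesEnv Γ σ ρ → Realizes A (subst σ t) (f ρ)

theorem Denotes.curry {Γ : Ctx} {t : Term S} {A B : Proposition} {f : Env S → Sem S B}
    (h : Denotes (Ctx.cons A Γ) t B f) :
    ∃ g : Env S → Sem S A →ₗ[S] Sem S B, Multilinear Γ g ∧
      ∀ σ ρ, RealizesEnv Γ σ ρ → ∀ u x, Realizes A u x →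
        Realizes B ((subst (upSubst σ) t).inst u) (g ρ x) := by
  obtain ⟨g, hg, hgf⟩ := h.multilinear.curry
  refine ⟨g, hg, fun σ ρ hσ u x hu => ?_⟩
  rw [inst_subst_upSubst, hgf]
  exact h.realizes _ _ (hσ.cons hu)

/-- Fundamental lemma of the logical relation. The denotation is built along the derivation,
existentially because derivations live in `Prop`. -/
theorem HasType.exists_denotes {Γ : Ctx} {t : Term S} {A : Proposition} (h : HasType Γ t A) :
    ∃ f, Denotes Γ t A f := by
  induction h with
  | ax hn hΓ => exact ⟨_, .proj hn hΓ, fun σ ρ hσ => hσ _ _ hn⟩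
  | sum _ _ ih ih' =>
    obtain ⟨f, hf⟩ := ih
    obtain ⟨g, hg⟩ := ih'
    exact ⟨_, hf.multilinear.add hg.multilinear, fun σ ρ hσ =>
      (hf.realizes σ ρ hσ).sum (hg.realizes σ ρ hσ)⟩
  | prod a _ ih =>
    obtain ⟨f, hf⟩ := ih
    exact ⟨_, hf.multilinear.smul a, fun σ ρ hσ => (hf.realizes σ ρ hσ).prod a⟩
  | topI a hΓ => exact ⟨fun _ => (a : S), .const hΓ (M := Sem S .top) a, fun _ _ _ => Conv.refl _⟩
  | @topE _ _ _ _ _ A hs _ _ ih ih' =>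
    obtain ⟨f, hf⟩ := ih
    obtain ⟨g, hg⟩ := ih'
    -- A scalar is read as the map multiplying by it, since `δ_⊤(a.⋆, u)` reduces to `a • u`.
    have hf' := Multilinear.comp (M := Sem S .top) (LinearMap.lsmul S (Sem S A)) hf.multilinear
    refine ⟨_, hf'.apply hs hg.multilinear, fun σ ρ hσ => ?_⟩
    exact ((hg.realizes σ ρ (hσ.right hs)).prod _).conv
      ((Conv.elimTop (hf.realizes σ ρ (hσ.left hs)) _).trans (Conv.of_step (Step.topBeta _ _)))
  | botE hs _ ih =>
    obtain ⟨f, hf⟩ := ih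
    -- `⊥` has no realizers, so only multilinearity is at stake.
    exact ⟨_, .zero, fun σ ρ hσ => (hf.realizes σ ρ (hσ.left hs)).elim⟩
  | impI _ ih =>
    obtain ⟨f, hf⟩ := ih
    obtain ⟨g, hg, hr⟩ := hf.curry
    exact ⟨g, hg, fun σ ρ hσ => ⟨⟨_, Conv.refl _⟩, fun u x hu =>
      (hr σ ρ hσ u x hu).conv (Conv.of_step (Step.impBeta _ _))⟩⟩
  | @impE _ _ _ _ _ A B hs _ _ ih ih' =>
    obtain ⟨f, hf⟩ := ih
    obtain ⟨g, hg⟩ := ih'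
    exact ⟨_, Multilinear.apply (M := Sem S A) (N := Sem S B) hs hf.multilinear hg.multilinear,
      fun σ ρ hσ => (hf.realizes σ ρ (hσ.left hs)).2 _ _ (hg.realizes σ ρ (hσ.right hs))⟩
  | andI _ _ ih ih' =>
    obtain ⟨f, hf⟩ := ih
    obtain ⟨g, hg⟩ := ih'
    exact ⟨_, hf.multilinear.prodMk hg.multilinear, fun σ ρ hσ =>
      ⟨_, _, Conv.refl _, hf.realizes σ ρ hσ, hg.realizes σ ρ hσ⟩⟩
  | @andE1 _ _ _ _ _ A B C hs _ _ ih ih' =>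
    obtain ⟨f, hf⟩ := ih
    obtain ⟨g', hg'⟩ := ih'
    obtain ⟨g, hg, hr⟩ := hg'.curry
    have hf' := Multilinear.comp (LinearMap.fst S (Sem S A) (Sem S B)) hf.multilinear
    -- The body over `Δ` is the function and the eliminated term over `Γ` its argument, hence the
    -- reversed split.
    refine ⟨_, hg.apply hs.symm hf', fun σ ρ hσ => ?_⟩
    obtain ⟨v, w, h, hv, hw⟩ := hf.realizes σ ρ (hσ.left hs)
    exact (hr σ ρ (hσ.right hs) v _ hv).conv
      ((h.elimAnd1 _).trans (Conv.of_step (Step.andBeta1 _ _ _)))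
  | @andE2 _ _ _ _ _ A B C hs _ _ ih ih' =>
    obtain ⟨f, hf⟩ := ih
    obtain ⟨g', hg'⟩ := ih'
    obtain ⟨g, hg, hr⟩ := hg'.curry
    have hf' := Multilinear.comp (LinearMap.snd S (Sem S A) (Sem S B)) hf.multilinear
    refine ⟨_, hg.apply hs.symm hf', fun σ ρ hσ => ?_⟩
    obtain ⟨v, w, h, hv, hw⟩ := hf.realizes σ ρ (hσ.left hs)
    exact (hr σ ρ (hσ.right hs) w _ hw).conv
      ((h.elimAnd2 _).trans (Conv.of_step (Step.andBeta2 _ _ _)))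
  | @orI1 _ _ A B _ ih =>
    obtain ⟨f, hf⟩ := ih
    exact ⟨_, hf.multilinear.comp (LinearMap.inl S (Sem S A) (Sem S B)), fun σ ρ hσ =>
      RealizesOr.inl (hf.realizes σ ρ hσ)⟩
  | @orI2 _ _ A B _ ih =>
    obtain ⟨f, hf⟩ := ih
    exact ⟨_, hf.multilinear.comp (LinearMap.inr S (Sem S A) (Sem S B)), fun σ ρ hσ =>
      RealizesOr.inr (hf.realizes σ ρ hσ)⟩
  | @orE _ _ _ _ _ _ A B C hs _ _ _ ih ih₁ ih₂ =>
    obtain ⟨f, hf⟩ := ih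
    obtain ⟨g₁', hg₁'⟩ := ih₁
    obtain ⟨g₂', hg₂'⟩ := ih₂
    obtain ⟨g₁, hg₁, hr₁⟩ := hg₁'.curry
    obtain ⟨g₂, hg₂, hr₂⟩ := hg₂'.curry
    -- The branches share `Δ`, so they must combine linearly: `coprod` is linear in the pair of
    -- branch maps.
    have hg := (hg₁.prodMk hg₂).comp
      (LinearMap.coprodEquiv (M := Sem S A) (M₂ := Sem S B) (M₃ := Sem S C) S).toLinearMap
    exact ⟨_, hg.apply hs.symm hf.multilinear, fun σ ρ hσ =>
      Realizes.elimOr (g₁ ρ) (g₂ ρ) (hf.realizes σ ρ (hσ.left hs))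
        (hr₁ σ ρ (hσ.right hs)) (hr₂ σ ρ (hσ.right hs))⟩

theorem HasType.exists_realizes_of_closed {t : Term S} {A : Proposition}
    (h : HasType Ctx.empty t A) : ∃ x, Realizes A t x := by
  obtain ⟨f, hf⟩ := h.exists_denotes
  have := hf.realizes var (fun _ _ => 0) fun n A hn => by simp [Ctx.empty] at hn
  exact ⟨_, by rwa [subst_var] at this⟩

theorem HasType.exists_linearMap {t : Term S} {A B : Proposition}
    (h : HasType (Ctx.cons A Ctx.empty) t B) :
    ∃ g : Sem S A →ₗ[S] Sem S B, ∀ u x, Realizes A u x → Realizes B (t.inst u) (g x) := by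
  obtain ⟨f, hf⟩ := h.exists_denotes
  obtain ⟨g, -, hg⟩ := hf.multilinear.curry
  -- Any environment serves, as the remaining context is empty.
  refine ⟨g fun _ _ => 0, fun u x hu => ?_⟩
  have hσ : RealizesEnv Ctx.empty (var : ℕ → Term S) fun _ _ => 0 :=
    fun n A hn => by simp [Ctx.empty] at hn
  have hs : single u = scons u var := by funext n; cases n <;> rfl
  rw [hg, inst, hs]
  exact hf.realizes _ _ (hσ.cons hu)

end Realizability

end LinCalc

theorem mainTheorem1 {S : Type*} [Field S]
    (A B : LinCalc.Proposition) (hB : LinCalc.InV B)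
    (t u₁ u₂ : LinCalc.Term S)
    (ht : LinCalc.HasType (LinCalc.Ctx.cons A LinCalc.Ctx.empty) t B)
    (hirr : LinCalc.Irreducible t)
    (hu₁ : LinCalc.HasType LinCalc.Ctx.empty u₁ A)
    (hu₂ : LinCalc.HasType LinCalc.Ctx.empty u₂ A) :
    LinCalc.Conv (t.inst (LinCalc.Term.sum u₁ u₂))
        (LinCalc.Term.sum (t.inst u₁) (t.inst u₂)) ∧
      ∀ a : S, LinCalc.Conv (t.inst (LinCalc.Term.prod a u₁))
        (LinCalc.Term.prod a (t.inst u₁)) := by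
  obtain ⟨x₁, h₁⟩ := hu₁.exists_realizes_of_closed
  obtain ⟨x₂, h₂⟩ := hu₂.exists_realizes_of_closed
  obtain ⟨g, hg⟩ := ht.exists_linearMap
  refine ⟨?_, fun a => ?_⟩
  -- It remains that the right side realizes the same vector `g (x₁ + x₂)`.
  · refine LinCalc.Realizes.conv_of_inV hB (hg _ _ (h₁.sum h₂)) ?_
    rw [map_add]
    exact (hg _ _ h₁).sum (hg _ _ h₂)
  · refine LinCalc.Realizes.conv_of_inV hB (hg _ _ (h₁.prod a)) ?_
    rw [map_smul]
    exact (hg _ _ h₁).prod a
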